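/- Let $G$ be a group with a Garside structure $(G,P,\Delta)$ of finite type. That is, $P\subseteq G$ is a submonoid with $P\cap P^{-1}=\{1\}$ and $\Delta\in P$; the partial order $a\preccurlyeq b\Leftrightarrow a^{-1}b\in P$ on $G$ is a lattice order, with greatest common divisor $\wedge$; the set $[1,\Delta]=\{s\in G: 1\preccurlyeq s\preccurlyeq\Delta\}$ of simple elements is finite and generates $G$; $\Delta^{-1}P\Delta=P$; and for every $x\in P\setminus\{1\}$ the number $\|x\|=\sup\{k: x=a_1\cdots a_k \text{ with } a_i\in P\setminus\{1\}\}$ is finite (put $\|1\|=0$). Let $x=\Delta^p x_1\cdots x_r$ be the left normal form of $x\in G$, that is, $p\in\mathbb Z$, $r\ge 0$, every $x_i$ lies in $[1,\Delta]\setminus\{1,\Delta\}$, and $(x_i^{-1}\Delta)\wedge x_{i+1}=1$ for $1\le i<r$. Put $\inf(x)=p$ and $\ell(x)=r$ (the canonical length). Let $\iota(x)=x\Delta^{-\inf(x)}\wedge\Delta$ and $\mathfrak p(x)=\iota(x)\wedge\iota(x^{-1})$, and let $\mathfrak s(x)=\mathfrak p(x)^{-1}\,x\,\mathfrak p(x)$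 be the cyclic sliding of $x$. Let ${\rm SSS}(x)$, the super summit set of $x$, be the set of all conjugates of $x$ whose canonical length is minimal in the conjugacy class of $x$. Then for every $x\in G$: 1. If $\ell(x)$ is not minimal in the conjugacy class of $x$, then there is a positive integer $m<\|\Delta\|$ such that $\ell(\mathfrak s^m(x))<\ell(x)$. 2. Iterated cyclic sliding reaches the super summit set: there is an integer $M\ge 0$ such that $\mathfrak s^m(x)\in{\rm SSS}(x)$ for all $m\ge M$. -/

import Mathlib

/-- The relation `a ≼ b ↔ a⁻¹ b ∈ P` on a group, for a submonoid `P`. -/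
def PrefixLE {G : Type*} [Group G] (P : Submonoid G) (a b : G) : Prop :=
  a⁻¹ * b ∈ P

/-- The lengths of the decompositions of `x` as a product of nontrivial elements of `P`. -/
def factorLengths {G : Type*} [Group G] (P : Submonoid G) (x : G) : Set ℕ :=
  {k | ∃ l : List G, l.length = k ∧ (∀ a ∈ l, a ∈ P ∧ a ≠ 1) ∧ l.prod = x}

/-- A Garside structure `(G, P, Δ)` on a group `G`. -/
structure GarsideStructure (G : Type*) [Group G] where
  /-- the monoid of positive elements -/
  P : Submonoid G
  /-- the Garside element -/
  Δ : G
  garside_mem : Δ ∈ P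
  eq_one_of_mem_of_inv_mem : ∀ a : G, a ∈ P → a⁻¹ ∈ P → a = 1
  /-- `≼` is a lattice order: greatest common divisors exist -/
  exists_gcd : ∀ a b : G, ∃ d : G, PrefixLE P d a ∧ PrefixLE P d b ∧
    ∀ c : G, PrefixLE P c a → PrefixLE P c b → PrefixLE P c d
  /-- `≼` is a lattice order: least common multiples exist -/
  exists_lcm : ∀ a b : G, ∃ m : G, PrefixLE P a m ∧ PrefixLE P b m ∧
    ∀ c : G, PrefixLE P a c → PrefixLE P b c → PrefixLE P m c
  closure_simple : Subgroup.closure {s : G | PrefixLE P 1 s ∧ PrefixLE P s Δ} = ⊤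
  /-- `Δ⁻¹ P Δ = P` -/
  conj_mem_iff : ∀ a : G, Δ⁻¹ * a * Δ ∈ P ↔ a ∈ P
  /-- `‖x‖ < ∞` for every nontrivial positive element `x` -/
  bddAbove_factorLengths : ∀ x ∈ P, x ≠ 1 → BddAbove (factorLengths P x)

namespace GarsideStructure

variable {G : Type*} [Group G] (S : GarsideStructure G)

/-- The partial order `a ≼ b`. -/
def le (a b : G) : Prop := PrefixLE S.P a b

/-- The set `[1, Δ]` of simple elements. -/
def simples : Set G := {s | S.le 1 s ∧ S.le s S.Δ}

/-- The Garside structure is of finite type. -/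
def IsFiniteType : Prop := S.simples.Finite

/-- `‖x‖`, the largest number of factors in a decomposition of the positive element `x` into
nontrivial positive elements (for `x = 1` only the empty decomposition exists, so `‖1‖ = 0`). -/
noncomputable def norm (x : G) : ℕ := sSup (factorLengths S.P x)

/-- The greatest common divisor `a ∧ b` with respect to `≼`. -/
noncomputable def gcd (a b : G) : G := (S.exists_gcd a b).choose

/-- The right complement `∂ s = s⁻¹ Δ`. -/
def rightComplement (s : G) : G := s⁻¹ * S.Δ

/-- `a · b` is left weighted: `∂ a ∧ b = 1`. -/
def LeftWeighted (a b : G) : Prop := S.gcd (S.rightComplement a) b = 1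

/-- `x = Δ ^ p * x₁ ⋯ xᵣ`, with `l = [x₁, …, xᵣ]`, is the left normal form of `x`. -/
def IsLeftNormalForm (x : G) (p : ℤ) (l : List G) : Prop :=
  x = S.Δ ^ p * l.prod ∧ (∀ s ∈ l, s ∈ S.simples ∧ s ≠ 1 ∧ s ≠ S.Δ) ∧
    l.IsChain S.LeftWeighted

/-- The left normal form `(p, [x₁, …, xᵣ])` of `x`. -/
noncomputable def leftNormalForm (x : G) : ℤ × List G :=
  Classical.epsilon fun q : ℤ × List G => S.IsLeftNormalForm x q.1 q.2

/-- The infimum `inf x = p`, where `Δ ^ p * x₁ ⋯ xᵣ` is the left normal form of `x`. -/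
noncomputable def inf (x : G) : ℤ := (S.leftNormalForm x).1

/-- The canonical length `ℓ(x) = r`, where `Δ ^ p * x₁ ⋯ xᵣ` is the left normal form of `x`. -/
noncomputable def len (x : G) : ℕ := (S.leftNormalForm x).2.length

/-- The initial factor `ι(x) = x Δ ^ (-inf x) ∧ Δ`. -/
noncomputable def initialFactor (x : G) : G := S.gcd (x * S.Δ ^ (-S.inf x)) S.Δ

/-- The preferred prefix `𝔭(x) = ι(x) ∧ ι(x⁻¹)`. -/
noncomputable def preferredPrefix (x : G) : G :=
  S.gcd (S.initialFactor x) (S.initialFactor x⁻¹)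

/-- The cyclic sliding `𝔰(x) = 𝔭(x)⁻¹ x 𝔭(x)`. -/
noncomputable def cyclicSliding (x : G) : G :=
  (S.preferredPrefix x)⁻¹ * x * S.preferredPrefix x

/-- The super summit set of `x`: the conjugates of `x` whose canonical length is minimal in the
conjugacy class of `x`. -/
def superSummitSet (x : G) : Set G :=
  {y | IsConj x y ∧ ∀ z, IsConj x z → S.len y ≤ S.len z}

end GarsideStructure

/-!
Fix `x` with infimum `p` and supremum `s = p + ℓ(x)`, so that `Δ ^ q ≼ x` iff `q ≤ p`
(`zpow_le_iff_le_inf`) and `x ≼ Δ ^ q` iff `s ≤ q` (`le_zpow_iff_sup_le`). Sliding never lowers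
the infimum, and never raises the supremum since `𝔰(x⁻¹) = 𝔰(x)⁻¹`. If some conjugate is shorter
than `x`, it has a larger infimum or a smaller supremum; replacing `x` by `x⁻¹`, assume the former.

The maps `f a = x a Δ ^ (-(p + 1))`, `g a = x⁻¹ a Δ ^ (s - 1)` and `D a = a Δ` are commuting
automorphisms of the lattice `(G, ≼)`. The conjugate `a⁻¹ x a` has infimum larger than `p` iff
`a ≼ f a`. As long as infimum and supremum do not change, `k` slidings amount to conjugating by
`D ^ k` applied to the `k`-th iterate of `a ↦ a ∧ f a ∧ g a` from `1`
(`cyclicSliding_iterate_eq`). If `ℓ(x) ≥ 2` then `a ≼ f (g a)`, and this iterate is the meet of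
the iterates `u k` of `a ↦ a ∧ f a` and `v k` of `a ↦ a ∧ g a` (`iterate_inf_inf_eq`); hence it
is a fixed point of `a ↦ a ∧ f a` as soon as `u k` is (`iterate_inf_inf_le_map`).

The heart of the proof is that `u (‖Δ‖ - 1)` is such a fixed point (`iterate_inf_le_map`). The
given conjugate provides some `β ≼ 1` with `β ≼ f β`, so the descending sequence `u` stays above
`β` and becomes stationary at an element `θ`. The meets `u k ∧ θ Δ` are successive iterates of
`a ↦ a ∧ f a` as well, so they descend strictly until they reach `θ`. They lie in `[θ, θ Δ]` and
differ from `θ Δ`, whence fewer than `‖Δ‖` steps suffice; and `u k ∧ θ Δ = θ` forces `u k = θ`,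
because `e ∧ Δ = 1` implies `e = 1` for positive `e`.

If `ℓ(x) ≤ 1`, then `f 1 ≼ 1` and `u k = f^[k] 1` could only be stationary if `1 ≼ f 1`, that is,
`Δ ^ (p + 1) ≼ x`, which is false.
-/

namespace GarsideStructure

variable {G : Type*} [Group G] (S : GarsideStructure G)

/-! ### The order and its translations -/

lemma le_refl (a : G) : S.le a a := by
  simp [le, PrefixLE, S.P.one_mem]

lemma le_trans {a b c : G} (h₁ : S.le a b) (h₂ : S.le b c) : S.le a c := by
  have := S.P.mul_mem h₁ h₂
  simpa [le, PrefixLE, mul_assoc] using this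

lemma le_antisymm {a b : G} (h₁ : S.le a b) (h₂ : S.le b a) : a = b := by
  have := S.eq_one_of_mem_of_inv_mem (a⁻¹ * b) h₁ (by simpa [le, PrefixLE] using h₂)
  exact inv_mul_eq_one.mp this

lemma one_le_iff {a : G} : S.le 1 a ↔ a ∈ S.P := by simp [le, PrefixLE]

lemma mul_le_mul_left_iff (c : G) {a b : G} : S.le (c * a) (c * b) ↔ S.le a b := by
  simp [le, PrefixLE, mul_assoc]

lemma le_inv_mul_iff {a b c : G} : S.le a (c⁻¹ * b) ↔ S.le (c * a) b := by
  simp [le, PrefixLE, mul_assoc]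

lemma inv_mul_le_iff {a b c : G} : S.le (c⁻¹ * a) b ↔ S.le a (c * b) := by
  simp [le, PrefixLE, mul_assoc]

lemma le_mul_of_mem {a b : G} (hb : b ∈ S.P) : S.le a (a * b) := by
  simpa [le, PrefixLE] using hb

/-- Right multiplication by `Δ` preserves `≼`, because conjugation by `Δ` preserves `P`. -/
lemma mul_garside_le_iff {a b : G} : S.le (a * S.Δ) (b * S.Δ) ↔ S.le a b := by
  have := S.conj_mem_iff (a⁻¹ * b)
  simpa [le, PrefixLE, mul_assoc] using this

lemma mul_zpow_le_iff (k : ℤ) {a b : G} :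
    S.le (a * S.Δ ^ k) (b * S.Δ ^ k) ↔ S.le a b := by
  induction k with
  | zero => simp
  | succ n ih => rw [zpow_add_one, ← mul_assoc, ← mul_assoc, mul_garside_le_iff, ih]
  | pred n ih =>
    rw [← ih, ← S.mul_garside_le_iff, mul_assoc, mul_assoc, ← zpow_add_one]; simp

lemma mul_zpow_le_iff_le_mul (k : ℤ) {a b : G} :
    S.le (a * S.Δ ^ k) b ↔ S.le a (b * S.Δ ^ (-k)) := by
  rw [← S.mul_zpow_le_iff k (b := b * S.Δ ^ (-k)), mul_assoc b, ← zpow_add]; simp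

lemma le_mul_zpow_iff (k : ℤ) {a b : G} :
    S.le a (b * S.Δ ^ k) ↔ S.le (a * S.Δ ^ (-k)) b := by
  rw [mul_zpow_le_iff_le_mul, neg_neg]

/-- `Δ ^ k ≼ x⁻¹` says that `Δ ^ (-k) x⁻¹` is positive, and `x ≼ Δ ^ (-k)` that its conjugate
`x⁻¹ Δ ^ (-k)` is. -/
lemma zpow_le_inv_iff (k : ℤ) {x : G} : S.le (S.Δ ^ k) x⁻¹ ↔ S.le x (S.Δ ^ (-k)) := by
  have := S.mul_zpow_le_iff_le_mul k (a := 1) (b := x⁻¹)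
  rw [one_mul] at this
  rw [this, le_inv_mul_iff, mul_one]

lemma garside_pow_mem (n : ℕ) : S.Δ ^ n ∈ S.P := S.P.pow_mem S.garside_mem n

lemma zpow_le_zpow {m n : ℤ} (h : m ≤ n) : S.le (S.Δ ^ m) (S.Δ ^ n) := by
  obtain ⟨k, rfl⟩ := Int.le.dest h
  rw [zpow_add]
  exact S.le_mul_of_mem (by simpa using S.garside_pow_mem k)

/-! ### Greatest common divisors -/

lemma gcd_le_left (a b : G) : S.le (S.gcd a b) a := (S.exists_gcd a b).choose_spec.1

lemma gcd_le_right (a b : G) : S.le (S.gcd a b) b := (S.exists_gcd a b).choose_spec.2.1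

lemma le_gcd {a b c : G} (ha : S.le c a) (hb : S.le c b) : S.le c (S.gcd a b) :=
  (S.exists_gcd a b).choose_spec.2.2 c ha hb

lemma gcd_eq {a b d : G} (ha : S.le d a) (hb : S.le d b)
    (h : ∀ c, S.le c a → S.le c b → S.le c d) : S.gcd a b = d :=
  S.le_antisymm (h _ (S.gcd_le_left a b) (S.gcd_le_right a b)) (S.le_gcd ha hb)

lemma gcd_comm (a b : G) : S.gcd a b = S.gcd b a :=
  S.gcd_eq (S.gcd_le_right _ _) (S.gcd_le_left _ _) fun _ ha hb => S.le_gcd hb ha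

lemma mul_gcd (c a b : G) : c * S.gcd a b = S.gcd (c * a) (c * b) := by
  refine (S.gcd_eq ?_ ?_ fun d ha hb => ?_).symm
  · exact (S.mul_le_mul_left_iff c).2 (S.gcd_le_left a b)
  · exact (S.mul_le_mul_left_iff c).2 (S.gcd_le_right a b)
  · rw [← inv_mul_le_iff] at ha hb ⊢
    exact S.le_gcd ha hb

lemma gcd_mul_zpow (a b : G) (k : ℤ) :
    S.gcd a b * S.Δ ^ k = S.gcd (a * S.Δ ^ k) (b * S.Δ ^ k) := by
  refine (S.gcd_eq ?_ ?_ fun d ha hb => ?_).symm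
  · exact (S.mul_zpow_le_iff k).2 (S.gcd_le_left a b)
  · exact (S.mul_zpow_le_iff k).2 (S.gcd_le_right a b)
  · rw [le_mul_zpow_iff] at ha hb ⊢
    exact S.le_gcd ha hb

/-- The semilattice of `≼`, whose meet is `gcd`. -/
@[reducible] noncomputable def semilatticeInf : SemilatticeInf G where
  le := S.le
  le_refl := S.le_refl
  le_trans _ _ _ := S.le_trans
  le_antisymm _ _ := S.le_antisymm
  inf := S.gcd
  inf_le_left := S.gcd_le_left
  inf_le_right := S.gcd_le_right
  le_inf _ _ _ := S.le_gcd

/-- If `y ≼ Δ ^ (k + 1)`, then cancelling the head `y ∧ Δ` leaves a left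
divisor of `Δ ^ k`. -/
lemma le_gcd_mul_pow {y : G} {k : ℕ} (h : S.le y (S.Δ ^ (k + 1))) :
    S.le y (S.gcd y S.Δ * S.Δ ^ k) := by
  rw [← zpow_natCast, gcd_mul_zpow, zpow_natCast, ← pow_succ']
  exact S.le_gcd (S.le_mul_of_mem (S.garside_pow_mem k)) h

/-- The simple elements generate `G`, so every element lies below a power of `Δ`. -/
lemma exists_le_pow (g : G) : ∃ m : ℕ, S.le g (S.Δ ^ m) := by
  suffices ∃ m : ℕ, S.le g (S.Δ ^ m) ∧ S.le g⁻¹ (S.Δ ^ m) from this.imp fun _ h => h.1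
  have hg : g ∈ Subgroup.closure {s : G | PrefixLE S.P 1 s ∧ PrefixLE S.P s S.Δ} := by
    rw [S.closure_simple]; trivial
  have key : ∀ {a b : G} {m n : ℕ}, S.le a (S.Δ ^ m) → S.le b (S.Δ ^ n) →
      S.le (a * b) (S.Δ ^ (m + n)) := by
    intro a b m n ha hb
    rw [pow_add]
    refine S.le_trans ((S.mul_le_mul_left_iff a).2 hb) ?_
    rw [← zpow_natCast S.Δ n]
    exact (S.mul_zpow_le_iff n).2 ha
  induction hg using Subgroup.closure_induction with
  | mem s hs =>
    refine ⟨1, by rw [pow_one]; exact hs.2, ?_⟩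
    refine S.le_trans (b := 1) ?_ ((S.one_le_iff).2 (S.garside_pow_mem 1))
    simpa [le, PrefixLE] using hs.1
  | one => exact ⟨0, by simpa using S.le_refl 1⟩
  | mul a b _ _ iha ihb =>
    obtain ⟨m, h₁, h₂⟩ := iha
    obtain ⟨n, h₃, h₄⟩ := ihb
    refine ⟨m + n, key h₁ h₃, ?_⟩
    rw [mul_inv_rev, add_comm]
    exact key h₄ h₂
  | inv a _ ih =>
    obtain ⟨m, h₁, h₂⟩ := ih
    exact ⟨m, h₂, by simpa using h₁⟩

/-- A nontrivial positive element has a nontrivial common divisor with `Δ`. -/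
lemma eq_one_of_gcd_eq_one {y : G} (hy : y ∈ S.P) (h : S.gcd y S.Δ = 1) : y = 1 := by
  obtain ⟨m, hm⟩ := S.exists_le_pow y
  induction m with
  | zero => exact S.le_antisymm (by simpa using hm) (S.one_le_iff.2 hy)
  | succ k ih => exact ih (by simpa [h] using S.le_gcd_mul_pow hm)

/-! ### The norm -/

lemma bddAbove_factorLengths' {x : G} (hx : x ∈ S.P) : BddAbove (factorLengths S.P x) := by
  by_cases h : x = 1
  · subst h
    refine ⟨0, ?_⟩
    rintro k ⟨l, rfl, hl, hp⟩
    cases l with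
    | nil => simp
    | cons a l =>
      exfalso
      rw [List.prod_cons] at hp
      have hl' : l.prod ∈ S.P := S.P.list_prod_mem fun b hb => (hl b (by simp [hb])).1
      refine (hl a (by simp)).2 (S.eq_one_of_mem_of_inv_mem a (hl a (by simp)).1 ?_)
      rwa [inv_eq_of_mul_eq_one_right hp]
  · exact S.bddAbove_factorLengths x hx h

lemma le_norm {x : G} (hx : x ∈ S.P) {k : ℕ} (hk : k ∈ factorLengths S.P x) : k ≤ S.norm x :=
  le_csSup (S.bddAbove_factorLengths' hx) hk

lemma norm_mem_factorLengths {x : G} (hx : x ∈ S.P) : S.norm x ∈ factorLengths S.P x := by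
  refine Nat.sSup_mem ?_ (S.bddAbove_factorLengths' hx)
  by_cases h : x = 1
  · exact ⟨0, [], rfl, by simp, by simp [h]⟩
  · exact ⟨1, [x], rfl, by simp [hx, h], by simp⟩

lemma norm_lt_norm_mul {x y : G} (hx : x ∈ S.P) (hy : y ∈ S.P) (h : y ≠ 1) :
    S.norm x < S.norm (x * y) := by
  obtain ⟨l, hl, hP, rfl⟩ := S.norm_mem_factorLengths hx
  refine S.le_norm (S.P.mul_mem hx hy) ⟨l ++ [y], by simp [hl], ?_, by simp⟩
  intro a ha
  rcases List.mem_append.1 ha with h' | h'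
  · exact hP a h'
  · rw [List.mem_singleton.1 h']; exact ⟨hy, h⟩

lemma norm_inv_mul_lt {c a b : G} (h₁ : S.le c a) (h₂ : S.le a b) (h : a ≠ b) :
    S.norm (c⁻¹ * a) < S.norm (c⁻¹ * b) := by
  have := S.norm_lt_norm_mul h₁ h₂ (by rwa [Ne, inv_mul_eq_one])
  simpa [mul_assoc] using this

/-! ### Normal forms, infimum and supremum -/

lemma prod_mem_of_forall_simple {l : List G} (hl : ∀ s ∈ l, s ∈ S.simples) : l.prod ∈ S.P :=
  S.P.list_prod_mem fun s hs => S.one_le_iff.1 (hl s hs).1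

lemma prod_le_pow_length {l : List G} (hl : ∀ s ∈ l, s ∈ S.simples) :
    S.le l.prod (S.Δ ^ l.length) := by
  induction l with
  | nil => simpa using S.le_refl 1
  | cons s l ih =>
    rw [List.prod_cons, List.length_cons, pow_succ']
    refine S.le_trans ((S.mul_le_mul_left_iff s).2 (ih fun t ht => hl t (by simp [ht]))) ?_
    rw [← zpow_natCast]
    exact (S.mul_zpow_le_iff _).2 (hl s (by simp)).2

lemma gcd_eq_one_of_le {a b : G} (ha : a ∈ S.P) (hb : b ∈ S.P)
    (h : ∀ c, S.le c a → S.le c b → S.le c 1) : S.gcd a b = 1 :=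
  S.gcd_eq (S.one_le_iff.2 ha) (S.one_le_iff.2 hb) h

/-- The head of a left weighted product of simple elements is its greatest simple divisor. -/
lemma gcd_prod_garside {s : G} {l : List G} (hl : ∀ t ∈ s :: l, t ∈ S.simples)
    (hc : (s :: l).IsChain S.LeftWeighted) : S.gcd (s :: l).prod S.Δ = s := by
  induction l generalizing s with
  | nil =>
    have := hl s (by simp)
    exact S.gcd_eq (by simpa using S.le_refl s) this.2 fun c h _ => by simpa using h
  | cons t l ih =>
    have hs := hl s (by simp)
    have ht : ∀ u ∈ t :: l, u ∈ S.simples := fun u hu => hl u (List.mem_cons_of_mem _ hu)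
    rw [List.isChain_cons_cons] at hc
    have h := ih ht hc.2
    rw [List.prod_cons]
    have h₁ : s * S.gcd (t :: l).prod (s⁻¹ * S.Δ) = S.gcd (s * (t :: l).prod) S.Δ := by
      rw [mul_gcd, mul_inv_cancel_left]
    rw [← h₁, S.gcd_eq_one_of_le (S.prod_mem_of_forall_simple ht) hs.2, mul_one]
    intro c hc₁ hc₂
    have h₂ : S.gcd (s⁻¹ * S.Δ) t = 1 := hc.1
    rw [← h₂]
    refine S.le_gcd hc₂ ?_
    rw [← h]
    refine S.le_gcd hc₁ (S.le_trans hc₂ ?_)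
    -- `∂ s ≼ Δ`, since `Δ = ∂ s · (Δ⁻¹ s Δ)`
    have := (S.conj_mem_iff s).2 (S.one_le_iff.1 hs.1)
    simpa [le, PrefixLE, mul_assoc] using this

/-- A left weighted product of `r` nontrivial simple elements divides no power of `Δ` below the
`r`-th. -/
lemma length_le_of_prod_le_pow {l : List G} (hl : ∀ t ∈ l, t ∈ S.simples ∧ t ≠ 1)
    (hc : l.IsChain S.LeftWeighted) {k : ℕ} (h : S.le l.prod (S.Δ ^ k)) : l.length ≤ k := by
  induction l generalizing k with
  | nil => simp
  | cons s l ih =>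
    have hs : ∀ t ∈ s :: l, t ∈ S.simples := fun t ht => (hl t ht).1
    have hP := S.prod_mem_of_forall_simple hs
    have hg := S.gcd_prod_garside hs hc
    cases k with
    | zero =>
      refine absurd ?_ (hl s (by simp)).2
      rw [← hg, S.le_antisymm (by simpa using h) (S.one_le_iff.2 hP)]
      exact S.gcd_eq_one_of_le S.P.one_mem S.garside_mem fun c h _ => h
    | succ k =>
      have := S.le_gcd_mul_pow h
      rw [hg, List.prod_cons, mul_le_mul_left_iff] at this
      have := ih (fun t ht => hl t (by simp [ht])) hc.tail this
      simpa using this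

/-- The greedy algorithm: splitting off `y ∧ Δ` repeatedly gives the normal form. -/
lemma exists_chain_of_le_pow (k : ℕ) {y : G} (hy : y ∈ S.P) (hk : S.le y (S.Δ ^ k))
    (h : ¬ S.le S.Δ y) : ∃ l : List G, l.prod = y ∧
      (∀ s ∈ l, s ∈ S.simples ∧ s ≠ 1 ∧ s ≠ S.Δ) ∧ l.IsChain S.LeftWeighted := by
  induction k generalizing y with
  | zero => exact ⟨[], S.le_antisymm (by simpa using S.one_le_iff.2 hy) (by simpa using hk), by simp⟩
  | succ k ih =>
    by_cases h1 : y = 1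
    · exact ⟨[], by simp [h1]⟩
    set s := S.gcd y S.Δ with hs
    have hsy : S.le s y := S.gcd_le_left _ _
    have hsD : S.le s S.Δ := S.gcd_le_right _ _
    have hs1 : s ≠ 1 := fun h' => h1 (S.eq_one_of_gcd_eq_one hy h')
    have hsΔ : s ≠ S.Δ := fun h' => h (h' ▸ hsy)
    have hs0 : S.le 1 s := S.le_gcd (S.one_le_iff.2 hy) (S.one_le_iff.2 S.garside_mem)
    have hw : S.gcd (S.rightComplement s) (s⁻¹ * y) = 1 := by
      rw [rightComplement, ← mul_gcd, S.gcd_comm, ← hs, inv_mul_cancel]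
    have hk' : S.le (s⁻¹ * y) (S.Δ ^ k) := S.inv_mul_le_iff.2 (S.le_gcd_mul_pow hk)
    have h' : ¬ S.le S.Δ (s⁻¹ * y) := by
      intro hle
      apply hsΔ
      have h₁ : S.le (S.rightComplement s) 1 := by
        rw [← hw]
        refine S.le_gcd (S.le_refl _) (S.le_trans ?_ hle)
        have := (S.conj_mem_iff s).2 (S.one_le_iff.1 hs0)
        simpa [le, PrefixLE, rightComplement, mul_assoc] using this
      exact inv_mul_eq_one.1 (S.le_antisymm h₁ (S.one_le_iff.2 hsD))
    obtain ⟨l, hlp, hl, hlc⟩ := ih hsy hk' h'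
    refine ⟨s :: l, by simp [hlp], ?_, ?_⟩
    · intro t ht
      rcases List.mem_cons.1 ht with rfl | ht
      · exact ⟨⟨hs0, hsD⟩, hs1, hsΔ⟩
      · exact hl t ht
    · cases l with
      | nil => simp
      | cons t l =>
        refine List.isChain_cons_cons.2 ⟨?_, hlc⟩
        refine S.gcd_eq_one_of_le hsD (S.one_le_iff.1 (hl t (by simp)).1.1) fun c h₁ h₂ => ?_
        rw [← hw]
        refine S.le_gcd h₁ (S.le_trans h₂ ?_)
        rw [← hlp, List.prod_cons]
        exact S.le_mul_of_mem
          (S.prod_mem_of_forall_simple fun u hu => (hl u (by simp [hu])).1)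

lemma le_norm_of_pow_le (hΔ : S.Δ ≠ 1) {k : ℕ} {y : G} (hk : S.le (S.Δ ^ k) y) (hy : y ∈ S.P) :
    k ≤ S.norm y := by
  by_cases h : (S.Δ ^ k)⁻¹ * y = 1
  · refine S.le_norm hy ⟨List.replicate k S.Δ, by simp, ?_, ?_⟩
    · intro a ha
      rw [List.eq_of_mem_replicate ha]
      exact ⟨S.garside_mem, hΔ⟩
    · rw [List.prod_replicate]
      exact inv_mul_eq_one.1 h
  · have h₁ := S.le_norm (S.garside_pow_mem k) (k := k)
      ⟨List.replicate k S.Δ, by simp, fun a ha => by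
        rw [List.eq_of_mem_replicate ha]; exact ⟨S.garside_mem, hΔ⟩, by simp⟩
    have h₂ := S.norm_lt_norm_mul (S.garside_pow_mem k) hk h
    rw [mul_inv_cancel_left] at h₂
    omega

lemma exists_isLeftNormalForm (hΔ : S.Δ ≠ 1) (x : G) :
    ∃ q : ℤ × List G, S.IsLeftNormalForm x q.1 q.2 := by
  obtain ⟨m, hm⟩ := S.exists_le_pow x⁻¹
  have hx : S.le (S.Δ ^ (-(m : ℤ))) x := by
    have := (S.zpow_le_inv_iff (-(m : ℤ)) (x := x⁻¹)).2 (by simpa using hm)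
    simpa using this
  -- the largest power of `Δ` dividing `x`
  obtain ⟨p, hp, hmax⟩ := Int.exists_greatest_of_bdd (P := fun q => S.le (S.Δ ^ q) x) ⟨_, by
    intro q hq
    show q ≤ (S.norm ((S.Δ ^ (-(m : ℤ)))⁻¹ * x) : ℤ) - m
    rcases le_or_gt q (-m) with h | h
    · have : (0 : ℤ) ≤ S.norm ((S.Δ ^ (-(m : ℤ)))⁻¹ * x) := by positivity
      linarith
    · obtain ⟨k, hk⟩ := Int.le.dest h.le
      have := S.le_norm_of_pow_le hΔ (k := k) (y := (S.Δ ^ (-(m : ℤ)))⁻¹ * x) (by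
        rw [le_inv_mul_iff, ← zpow_natCast, ← zpow_add, hk]; exact hq) hx
      omega⟩ ⟨_, hx⟩
  obtain ⟨k, hk⟩ := S.exists_le_pow ((S.Δ ^ p)⁻¹ * x)
  obtain ⟨l, hl, hl', hc⟩ := S.exists_chain_of_le_pow k hp hk (by
    intro h
    rw [le_inv_mul_iff, ← zpow_add_one] at h
    have := hmax _ h
    omega)
  exact ⟨(p, l), by simp [hl], hl', hc⟩

lemma isLeftNormalForm_leftNormalForm (hΔ : S.Δ ≠ 1) (x : G) :
    S.IsLeftNormalForm x (S.inf x) (S.leftNormalForm x).2 :=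
  Classical.epsilon_spec (S.exists_isLeftNormalForm hΔ x)

/-- The supremum `sup x = inf x + ℓ(x)`. -/
noncomputable def sup (x : G) : ℤ := S.inf x + S.len x

lemma zpow_le_iff_le_inf (hΔ : S.Δ ≠ 1) {x : G} {q : ℤ} :
    S.le (S.Δ ^ q) x ↔ q ≤ S.inf x := by
  obtain ⟨hx, hl, hc⟩ := S.isLeftNormalForm_leftNormalForm hΔ x
  set l := (S.leftNormalForm x).2
  set p := S.inf x
  have hs : ∀ t ∈ l, t ∈ S.simples := fun t ht => (hl t ht).1
  have hP := S.prod_mem_of_forall_simple hs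
  constructor
  · intro h
    by_contra! hlt
    have h₁ : S.le S.Δ l.prod := by
      have := S.le_trans (S.zpow_le_zpow (Int.add_one_le_of_lt hlt)) h
      rw [hx, zpow_add_one, mul_le_mul_left_iff] at this
      exact this
    cases hl' : l with
    | nil =>
      rw [hl', List.prod_nil] at h₁
      exact hΔ (S.le_antisymm h₁ (S.one_le_iff.2 S.garside_mem))
    | cons s l' =>
      rw [hl'] at hs hc h₁ hl
      have h₂ := S.gcd_prod_garside hs hc
      refine (hl s (by simp)).2.2 (S.le_antisymm (hs s (by simp)).2 ?_)
      rw [← h₂]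
      exact S.le_gcd h₁ (S.le_refl _)
  · intro h
    refine S.le_trans (S.zpow_le_zpow h) ?_
    conv_rhs => rw [hx]
    exact S.le_mul_of_mem hP

lemma le_zpow_iff_sup_le (hΔ : S.Δ ≠ 1) {x : G} {q : ℤ} :
    S.le x (S.Δ ^ q) ↔ S.sup x ≤ q := by
  obtain ⟨hx, hl, hc⟩ := S.isLeftNormalForm_leftNormalForm hΔ x
  have hlen : S.sup x = S.inf x + ((S.leftNormalForm x).2.length : ℤ) := rfl
  set l := (S.leftNormalForm x).2
  set p := S.inf x
  have hs : ∀ t ∈ l, t ∈ S.simples := fun t ht => (hl t ht).1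
  have hP := S.prod_mem_of_forall_simple hs
  rw [hlen]
  constructor
  · intro h
    have hq : p ≤ q := by
      by_contra! hlt
      have h₁ : S.le (S.Δ ^ p) x := (S.zpow_le_iff_le_inf hΔ).2 le_rfl
      have h₂ := S.le_antisymm (S.zpow_le_zpow hlt.le) (S.le_trans h₁ h)
      have h₃ : S.le (S.Δ ^ (p + 1)) x := by
        refine S.le_trans ?_ h₁
        have h₄ : S.Δ ^ (p - q) = 1 := by rw [zpow_sub, h₂, mul_inv_cancel]
        have h₅ : S.le (S.Δ ^ (1 : ℤ)) 1 := by
          rw [← h₄]; exact S.zpow_le_zpow (by omega)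
        rw [zpow_add]
        simpa using (S.mul_le_mul_left_iff (S.Δ ^ p)).2 h₅
      have := (S.zpow_le_iff_le_inf hΔ).1 h₃
      omega
    obtain ⟨k, rfl⟩ := Int.le.dest hq
    rw [hx, zpow_add, mul_le_mul_left_iff, zpow_natCast] at h
    have := S.length_le_of_prod_le_pow (fun t ht => ⟨(hl t ht).1, (hl t ht).2.1⟩) hc h
    omega
  · intro h
    refine S.le_trans ?_ (S.zpow_le_zpow h)
    rw [zpow_add, zpow_natCast]
    conv_lhs => rw [hx]
    exact (S.mul_le_mul_left_iff _).2 (S.prod_le_pow_length hs)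

lemma inf_inv (hΔ : S.Δ ≠ 1) (x : G) : S.inf x⁻¹ = -S.sup x := by
  refine eq_of_forall_le_iff fun q => ?_
  rw [← S.zpow_le_iff_le_inf hΔ, zpow_le_inv_iff, S.le_zpow_iff_sup_le hΔ]
  omega

lemma sup_inv (hΔ : S.Δ ≠ 1) (x : G) : S.sup x⁻¹ = -S.inf x := by
  have := S.inf_inv hΔ x⁻¹
  rw [inv_inv] at this
  omega

lemma len_inv (hΔ : S.Δ ≠ 1) (x : G) : S.len x⁻¹ = S.len x := by
  have h₁ := S.inf_inv hΔ x
  have h₂ := S.sup_inv hΔ x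
  simp only [sup] at h₁ h₂
  omega

end GarsideStructure

/-! ### Iterating meets with a semilattice endomorphism -/

section SemilatticeInf

variable {L : Type*} [SemilatticeInf L]

lemma iterate_inf_le (f : L → L) (o : L) (k : ℕ) : (fun a => a ⊓ f a)^[k] o ≤ o := by
  induction k with
  | zero => exact le_rfl
  | succ k ih => rw [Function.iterate_succ_apply']; exact inf_le_left.trans ih

/-- If `f ∘ g` and `g ∘ f` are inflationary, the iteration of `a ↦ a ⊓ f a ⊓ g a` separates into
the iterations for `f` and for `g`. The last two conclusions make the induction work. -/
lemma iterate_inf_inf_eq {f g : L → L} (hf : ∀ a b, f (a ⊓ b) = f a ⊓ f b)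
    (hg : ∀ a b, g (a ⊓ b) = g a ⊓ g b) (hfg : ∀ a, a ≤ f (g a)) (hgf : ∀ a, a ≤ g (f a))
    (o : L) (k : ℕ) :
    (fun a => a ⊓ f a ⊓ g a)^[k] o =
        (fun a => a ⊓ f a)^[k] o ⊓ (fun a => a ⊓ g a)^[k] o ∧
      f o ⊓ (fun a => a ⊓ g a)^[k] o ≤ f ((fun a => a ⊓ g a)^[k] o) ∧
      g o ⊓ (fun a => a ⊓ f a)^[k] o ≤ g ((fun a => a ⊓ f a)^[k] o) := by
  have hfm : Monotone f := fun a b h => by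
    rw [← inf_eq_left] at h ⊢; rw [← hf, h]
  have hgm : Monotone g := fun a b h => by
    rw [← inf_eq_left] at h ⊢; rw [← hg, h]
  induction k with
  | zero => simp
  | succ k ih =>
    have hu := iterate_inf_le f o k
    have hv := iterate_inf_le g o k
    simp only [Function.iterate_succ_apply']
    set u := (fun a => a ⊓ f a)^[k] o
    set v := (fun a => a ⊓ g a)^[k] o
    obtain ⟨h, h₁, h₂⟩ := ih
    rw [h]
    refine ⟨le_antisymm ?_ ?_, ?_, ?_⟩
    · rw [hf, hg]
      refine le_inf (le_inf ?_ ?_) (le_inf ?_ ?_)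
      · exact inf_le_left.trans (inf_le_left.trans inf_le_left)
      · exact inf_le_left.trans (inf_le_right.trans inf_le_left)
      · exact inf_le_left.trans (inf_le_left.trans inf_le_right)
      · exact inf_le_right.trans inf_le_right
    · rw [hf, hg]
      refine le_inf (le_inf ?_ (le_inf ?_ ?_)) (le_inf ?_ ?_)
      · exact inf_le_inf inf_le_left inf_le_left
      · exact inf_le_left.trans inf_le_right
      · exact (inf_le_inf (inf_le_right.trans (hfm hu)) inf_le_left).trans h₁
      · refine le_trans ?_ h₂
        exact le_inf (inf_le_right.trans (inf_le_right.trans (hgm hv)))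
          (inf_le_left.trans inf_le_left)
      · exact inf_le_right.trans inf_le_right
    · rw [hf]
      refine le_inf (le_trans (inf_le_inf_left _ inf_le_left) h₁) ?_
      exact inf_le_right.trans (inf_le_left.trans (hfg v))
    · rw [hg]
      refine le_inf (le_trans (inf_le_inf_left _ inf_le_left) h₂) ?_
      exact inf_le_right.trans (inf_le_left.trans (hgf u))

/-- Iterating `a ↦ a ⊓ f a ⊓ g a` reaches `w ≤ f w` no later than iterating `a ↦ a ⊓ f a` does,
whether or not the iteration for `g` becomes stationary. -/
lemma iterate_inf_inf_le_map {f g : L → L} (hf : ∀ a b, f (a ⊓ b) = f a ⊓ f b)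
    (hg : ∀ a b, g (a ⊓ b) = g a ⊓ g b) (hfg : ∀ a, a ≤ f (g a)) (hgf : ∀ a, a ≤ g (f a))
    {o : L} {k : ℕ}
    (h : (fun a => a ⊓ f a)^[k] o ≤ f ((fun a => a ⊓ f a)^[k] o)) :
    (fun a => a ⊓ f a ⊓ g a)^[k] o ≤ f ((fun a => a ⊓ f a ⊓ g a)^[k] o) := by
  obtain ⟨h₁, h₂, -⟩ := iterate_inf_inf_eq hf hg hfg hgf o k
  have h₃ : f ((fun a => a ⊓ f a)^[k] o) ≤ f o := by
    rw [← inf_eq_left, ← hf, inf_eq_left.2 (iterate_inf_le f o k)]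
  rw [h₁, hf]
  exact le_inf (inf_le_left.trans h) ((inf_le_inf_right _ (h.trans h₃)).trans h₂)

/-- Let `f` commute with an inflationary map `D` such that every strict chain in `[c, D c]` has at
most `N` steps. If some `β ≤ o` satisfies `β ≤ f β`, then the iteration of `a ↦ a ⊓ f a` from `o`
reaches the greatest such element `θ` within `N - 1` steps. The reason is that its meet with
`D θ` is a chain in `[θ, D θ]` which misses the top and strictly decreases until it is `θ`. -/
lemma iterate_inf_le_map {f D : L → L} (hf : ∀ a b, f (a ⊓ b) = f a ⊓ f b)
    (hD : Monotone D) (hfD : ∀ a, f (D a) = D (f a)) (hDle : ∀ a, a ≤ D a)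
    (hDne : ∀ c, ¬ D c ≤ c) {ρ : L → L → ℕ} (hρ : ∀ c a b, c ≤ a → a < b → ρ c a < ρ c b)
    {N : ℕ} (hN : ∀ c, ρ c (D c) = N) (hcancel : ∀ c a, c ≤ a → a ⊓ D c = c → a = c)
    {o β : L} (hβo : β ≤ o) (hβ : β ≤ f β) :
    (fun a => a ⊓ f a)^[N - 1] o ≤ f ((fun a => a ⊓ f a)^[N - 1] o) := by
  have hfm : Monotone f := fun a b h => by
    rw [← inf_eq_left] at h ⊢; rw [← hf, h]
  obtain ⟨u, hu⟩ : ∃ u : ℕ → L, u = fun k => (fun a => a ⊓ f a)^[k] o := ⟨_, rfl⟩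
  have h0 : u 0 = o := by rw [hu]; rfl
  have hs : ∀ k, u (k + 1) = u k ⊓ f (u k) := fun k => by
    rw [hu]; exact Function.iterate_succ_apply' _ _ _
  change (fun k => (fun a => a ⊓ f a)^[k] o) (N - 1) ≤
    f ((fun k => (fun a => a ⊓ f a)^[k] o) (N - 1))
  rw [← hu]
  have hgood : ∀ γ, γ ≤ o → γ ≤ f γ → ∀ k, γ ≤ u k := by
    intro γ h₁ h₂ k
    induction k with
    | zero => rwa [h0]
    | succ k ih => rw [hs]; exact le_inf ih (h₂.trans (hfm ih))
  obtain ⟨K, hK⟩ : ∃ K, u K ≤ f (u K) := by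
    by_contra! hne
    have : ∀ k, ρ β (u k) + k ≤ ρ β o := by
      intro k
      induction k with
      | zero => rw [h0]; simp
      | succ k ih =>
        have hlt : u (k + 1) < u k := by
          refine lt_of_le_of_ne (hs k ▸ inf_le_left) fun h => hne k ?_
          rw [hs] at h
          exact inf_eq_left.1 h
        have := hρ β _ _ (hgood β hβo hβ (k + 1)) hlt
        omega
    have := this (ρ β o + 1)
    omega
  obtain ⟨θ, hθ⟩ : ∃ θ, θ = u K := ⟨_, rfl⟩
  rw [← hθ] at hK
  have hstable : ∀ i, u (K + i) = θ := by
    intro i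
    induction i with
    | zero => exact hθ.symm
    | succ i ih => rw [← add_assoc, hs, ih, inf_eq_left.2 hK]
  have hθo : θ ≤ o := by
    rw [hθ, hu]
    exact iterate_inf_le f o K
  have hDθ : D θ ≤ f (D θ) := by rw [hfD]; exact hD hK
  have hDo : ¬ D θ ≤ o := fun h => hDne θ (by
    have := hgood _ h hDθ K
    rwa [← hθ] at this)
  obtain ⟨η, hη⟩ : ∃ η : ℕ → L, ∀ k, η k = u k ⊓ D θ := ⟨_, fun _ => rfl⟩
  have hηs : ∀ k, η (k + 1) = η k ⊓ f (η k) := by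
    intro k
    rw [hη, hη, hs, hf]
    apply le_antisymm
    · refine le_inf (le_inf ?_ inf_le_right) (le_inf ?_ (inf_le_right.trans hDθ))
      · exact inf_le_left.trans inf_le_left
      · exact inf_le_left.trans inf_le_right
    · exact le_inf (inf_le_inf inf_le_left inf_le_left) (inf_le_left.trans inf_le_right)
  have hθη : ∀ k, θ ≤ η k := fun k => by
    rw [hη]; exact le_inf (hgood θ hθo hK k) (hDle θ)
  have hηstat : ∀ k, η (k + 1) = η k → η k = θ := by
    intro k h
    have : ∀ i, η (k + i) = η k := by
      intro i
      induction i with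
      | zero => rfl
      | succ i ih => rw [← add_assoc, hηs, ih, ← hηs, h]
    rw [← this K, hη, add_comm, hstable, inf_eq_left.2 (hDle θ)]
  have hcount : ∀ k, η k = θ ∨ ρ θ (η k) + k + 1 ≤ N := by
    intro k
    induction k with
    | zero =>
      right
      have : η 0 < D θ := by
        refine lt_of_le_of_ne (by rw [hη]; exact inf_le_right) fun h => hDo ?_
        rw [← h, hη, h0]
        exact inf_le_left
      have := hρ θ _ _ (hθη 0) this
      rw [hN] at this
      omega
    | succ k ih =>
      have hle : η (k + 1) ≤ η k := by rw [hηs]; exact inf_le_left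
      rcases ih with h | h
      · exact Or.inl (le_antisymm (h ▸ hle) (hθη _))
      · by_cases heq : η (k + 1) = η k
        · exact Or.inl (heq.trans (hηstat k heq))
        · have := hρ θ _ _ (hθη (k + 1)) (lt_of_le_of_ne hle heq)
          right
          omega
  have hfin : η (N - 1) = θ := by
    rcases hcount (N - 1) with h | h
    · exact h
    · by_contra hne
      have := hρ θ _ _ le_rfl (lt_of_le_of_ne (hθη (N - 1)) (Ne.symm hne))
      omega
  have : u (N - 1) = θ := hcancel θ _ (hgood θ hθo hK _) (by rw [← hη, hfin])
  rwa [this]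

/-- If `f o ≤ o`, the iteration of `a ↦ a ⊓ f a` from `o` is that of `f`, and it is never
stationary unless `o ≤ f o`. -/
lemma le_map_of_iterate_inf_le_map {f : L → L} (hf : ∀ a b, f a ≤ f b ↔ a ≤ b) {o : L}
    (ho : f o ≤ o) {k : ℕ}
    (h : (fun a => a ⊓ f a)^[k] o ≤ f ((fun a => a ⊓ f a)^[k] o)) : o ≤ f o := by
  have h₁ : ∀ k, f (f^[k] o) ≤ f^[k] o := by
    intro k
    induction k with
    | zero => exact ho
    | succ k ih => rw [Function.iterate_succ_apply']; exact (hf _ _).2 ih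
  have h₂ : ∀ k, (fun a => a ⊓ f a)^[k] o = f^[k] o := by
    intro k
    induction k with
    | zero => rfl
    | succ k ih =>
      rw [Function.iterate_succ_apply', Function.iterate_succ_apply', ih]
      exact inf_eq_right.2 (h₁ k)
  rw [h₂] at h
  clear h₂
  induction k with
  | zero => exact h
  | succ k ih =>
    rw [Function.iterate_succ_apply', hf] at h
    exact ih h

end SemilatticeInf

namespace GarsideStructure

variable {G : Type*} [Group G] (S : GarsideStructure G)

/-! ### Cyclic sliding -/

lemma preferredPrefix_eq (hΔ : S.Δ ≠ 1) (x : G) : S.preferredPrefix x =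
    S.gcd (S.gcd (x * S.Δ ^ (-S.inf x)) S.Δ) (S.gcd (x⁻¹ * S.Δ ^ S.sup x) S.Δ) := by
  rw [preferredPrefix, initialFactor, initialFactor, S.inf_inv hΔ, neg_neg]

lemma preferredPrefix_mem (hΔ : S.Δ ≠ 1) (x : G) : S.preferredPrefix x ∈ S.P := by
  have h₁ : S.le 1 (x * S.Δ ^ (-S.inf x)) := by
    rw [← mul_zpow_le_iff_le_mul, one_mul]
    exact (S.zpow_le_iff_le_inf hΔ).2 le_rfl
  have h₂ : S.le 1 (x⁻¹ * S.Δ ^ S.sup x) := by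
    rw [le_inv_mul_iff, mul_one]
    exact (S.le_zpow_iff_sup_le hΔ).2 le_rfl
  have h₃ := S.one_le_iff.2 S.garside_mem
  rw [S.preferredPrefix_eq hΔ, ← one_le_iff]
  exact S.le_gcd (S.le_gcd h₁ h₃) (S.le_gcd h₂ h₃)

lemma inf_le_inf_cyclicSliding (hΔ : S.Δ ≠ 1) (x : G) :
    S.inf x ≤ S.inf (S.cyclicSliding x) := by
  rw [← S.zpow_le_iff_le_inf hΔ, cyclicSliding, mul_assoc, le_inv_mul_iff,
    mul_zpow_le_iff_le_mul]
  have h : S.le (S.preferredPrefix x) (x * S.Δ ^ (-S.inf x)) := by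
    rw [S.preferredPrefix_eq hΔ]
    exact S.le_trans (S.gcd_le_left _ _) (S.gcd_le_left _ _)
  exact S.le_trans h ((S.mul_zpow_le_iff _).2 (S.le_mul_of_mem (S.preferredPrefix_mem hΔ x)))

/-- Cyclic sliding commutes with inversion, because `𝔭(x) = 𝔭(x⁻¹)`. -/
lemma cyclicSliding_inv (x : G) : S.cyclicSliding x⁻¹ = (S.cyclicSliding x)⁻¹ := by
  have : S.preferredPrefix x⁻¹ = S.preferredPrefix x := by
    rw [preferredPrefix, preferredPrefix, inv_inv, gcd_comm]
  rw [cyclicSliding, cyclicSliding, this]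
  group

lemma cyclicSliding_iterate_inv (x : G) (m : ℕ) :
    S.cyclicSliding^[m] x⁻¹ = (S.cyclicSliding^[m] x)⁻¹ := by
  induction m with
  | zero => rfl
  | succ m ih =>
    rw [Function.iterate_succ_apply', Function.iterate_succ_apply', ih, cyclicSliding_inv]

lemma sup_cyclicSliding_le_sup (hΔ : S.Δ ≠ 1) (x : G) :
    S.sup (S.cyclicSliding x) ≤ S.sup x := by
  have h := S.inf_le_inf_cyclicSliding hΔ x⁻¹
  rw [cyclicSliding_inv, S.inf_inv hΔ, S.inf_inv hΔ] at h
  omega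

lemma inf_le_inf_iterate (hΔ : S.Δ ≠ 1) (x : G) (m : ℕ) :
    S.inf x ≤ S.inf (S.cyclicSliding^[m] x) := by
  induction m with
  | zero => rfl
  | succ m ih =>
    rw [Function.iterate_succ_apply']
    exact ih.trans (S.inf_le_inf_cyclicSliding hΔ _)

lemma sup_iterate_le_sup (hΔ : S.Δ ≠ 1) (x : G) (m : ℕ) :
    S.sup (S.cyclicSliding^[m] x) ≤ S.sup x := by
  induction m with
  | zero => rfl
  | succ m ih =>
    rw [Function.iterate_succ_apply']
    exact (S.sup_cyclicSliding_le_sup hΔ _).trans ih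

lemma len_iterate_le_len (hΔ : S.Δ ≠ 1) (x : G) (m : ℕ) :
    S.len (S.cyclicSliding^[m] x) ≤ S.len x := by
  have h₁ := S.inf_le_inf_iterate hΔ x m
  have h₂ := S.sup_iterate_le_sup hΔ x m
  simp only [sup] at h₂
  omega

lemma isConj_cyclicSliding_iterate (x : G) (m : ℕ) : IsConj x (S.cyclicSliding^[m] x) := by
  induction m with
  | zero => exact IsConj.refl x
  | succ m ih =>
    rw [Function.iterate_succ_apply']
    refine ih.trans (isConj_iff.2 ⟨(S.preferredPrefix (S.cyclicSliding^[m] x))⁻¹, ?_⟩)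
    rw [inv_inv, cyclicSliding]

/-- The lattice automorphism `a ↦ x a Δ ^ q` of `G`. With `q = -(p + 1)`, the inequality
`a ≼ translate x q a` says that `Δ ^ (p + 1) ≼ a⁻¹ x a`. -/
def translate (x : G) (q : ℤ) (a : G) : G := x * a * S.Δ ^ q

lemma translate_gcd (x : G) (q : ℤ) (a b : G) :
    S.translate x q (S.gcd a b) = S.gcd (S.translate x q a) (S.translate x q b) := by
  rw [translate, mul_gcd, gcd_mul_zpow]; rfl

lemma translate_le_translate_iff (x : G) (q : ℤ) (a b : G) :
    S.le (S.translate x q a) (S.translate x q b) ↔ S.le a b := by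
  rw [translate, translate, mul_zpow_le_iff, mul_le_mul_left_iff]

/-- As long as infimum and supremum do not change, `k` cyclic slidings are the conjugation by
`a Δ ^ k`, where `a` is the `k`-th iterate, from `1`, of
`a ↦ a ∧ x a Δ ^ (-(inf x + 1)) ∧ x⁻¹ a Δ ^ (sup x - 1)`. -/
lemma cyclicSliding_iterate_eq (hΔ : S.Δ ≠ 1) (x : G) (k : ℕ)
    (h : ∀ j < k, S.inf (S.cyclicSliding^[j] x) = S.inf x ∧
      S.sup (S.cyclicSliding^[j] x) = S.sup x) (c : G)
    (hc : c = (fun a => S.gcd (S.gcd a (S.translate x (-(S.inf x + 1)) a))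
      (S.translate x⁻¹ (S.sup x - 1) a))^[k] 1 * S.Δ ^ (k : ℤ)) :
    S.cyclicSliding^[k] x = c⁻¹ * x * c := by
  induction k generalizing c with
  | zero => subst hc; simp
  | succ k ih =>
    obtain ⟨h₁, h₂⟩ := h k (Nat.lt_succ_self k)
    have ih := ih (fun j hj => h j (hj.trans (Nat.lt_succ_self k))) _ rfl
    rw [Function.iterate_succ_apply'] at hc ⊢
    set a := (fun a => S.gcd (S.gcd a (S.translate x (-(S.inf x + 1)) a))
      (S.translate x⁻¹ (S.sup x - 1) a))^[k] 1
    set y := S.cyclicSliding^[k] x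
    have hp : a * S.Δ ^ (k : ℤ) * S.preferredPrefix y = c := by
      have e₁ : a * S.Δ ^ (k : ℤ) * (y * S.Δ ^ (-S.inf x)) =
          S.translate x (-(S.inf x + 1)) a * S.Δ ^ ((k + 1 : ℕ) : ℤ) := by
        rw [ih, translate, Nat.cast_succ]; group
      have e₂ : a * S.Δ ^ (k : ℤ) * (y⁻¹ * S.Δ ^ S.sup x) =
          S.translate x⁻¹ (S.sup x - 1) a * S.Δ ^ ((k + 1 : ℕ) : ℤ) := by
        rw [ih, translate, Nat.cast_succ]; group
      have e₃ : a * S.Δ ^ (k : ℤ) * S.Δ = a * S.Δ ^ ((k + 1 : ℕ) : ℤ) := by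
        rw [Nat.cast_succ]; group
      have e₄ : ∀ A B C : G, S.gcd (S.gcd A B) (S.gcd C B) = S.gcd (S.gcd B A) C := by
        let _ := S.semilatticeInf
        intro A B C
        change A ⊓ B ⊓ (C ⊓ B) = B ⊓ A ⊓ C
        rw [← inf_inf_distrib_right, inf_comm, inf_assoc]
      rw [S.preferredPrefix_eq hΔ, h₁, h₂, mul_gcd, mul_gcd, mul_gcd, e₁, e₂, e₃, e₄,
        ← gcd_mul_zpow, ← gcd_mul_zpow, hc]
    rw [cyclicSliding, ← hp]
    generalize S.preferredPrefix y = b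
    rw [ih]
    group

lemma not_mul_garside_le (hΔ : S.Δ ≠ 1) (c : G) : ¬ S.le (c * S.Δ) c := by
  intro h
  have h₁ : S.le S.Δ 1 := by
    rw [← S.mul_le_mul_left_iff c, mul_one]; exact h
  exact hΔ (S.le_antisymm h₁ (S.one_le_iff.2 S.garside_mem))

/-- If a conjugate of `x` has larger infimum, then the iteration describing repeated cycling
reaches a conjugator that increases the infimum within `‖Δ‖ - 1` steps. -/
lemma exists_iterate_le_translate (hΔ : S.Δ ≠ 1) {x y : G} (hxy : IsConj x y) {p : ℤ}
    (hp : p < S.inf y) (θ : G)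
    (hθ : θ = (fun a => S.gcd a (S.translate x (-(p + 1)) a))^[S.norm S.Δ - 1] 1) :
    S.le θ (S.translate x (-(p + 1)) θ) := by
  obtain ⟨γ, rfl⟩ := isConj_iff.1 hxy
  have hγ : S.le γ⁻¹ (S.translate x (-(p + 1)) γ⁻¹) := by
    rw [translate, ← mul_zpow_le_iff_le_mul, ← le_inv_mul_iff, inv_inv,
      S.zpow_le_iff_le_inf hΔ, ← mul_assoc]
    exact hp
  obtain ⟨m, hm⟩ := S.exists_le_pow γ⁻¹
  subst hθ
  let _ := S.semilatticeInf
  refine iterate_inf_le_map (D := fun a => a * S.Δ) (ρ := fun c a => S.norm (c⁻¹ * a))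
    (o := 1) (β := γ⁻¹ * S.Δ ^ (-(m : ℤ))) (S.translate_gcd x _)
    (fun a b h => S.mul_garside_le_iff.2 h) ?_ (fun a => S.le_mul_of_mem S.garside_mem)
    (S.not_mul_garside_le hΔ) ?_ (fun c => by simp) ?_ ?_ ?_
  · intro a
    simp only [translate]
    group
  · exact fun c a b h₁ h₂ => S.norm_inv_mul_lt h₁ h₂.le h₂.ne
  · intro c a h₁ h₂
    have h₃ : S.gcd (c⁻¹ * a) S.Δ = 1 := by
      have : c⁻¹ * S.gcd a (c * S.Δ) = c⁻¹ * c := congrArg _ h₂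
      rwa [mul_gcd, inv_mul_cancel_left, inv_mul_cancel] at this
    exact (inv_mul_eq_one.1 (S.eq_one_of_gcd_eq_one h₁ h₃)).symm
  · have := (S.le_mul_zpow_iff (m : ℤ) (a := γ⁻¹) (b := 1)).1 (by simpa using hm)
    exact this
  · have e : S.translate x (-(p + 1)) (γ⁻¹ * S.Δ ^ (-(m : ℤ))) =
        S.translate x (-(p + 1)) γ⁻¹ * S.Δ ^ (-(m : ℤ)) := by
      simp only [translate]
      group
    rw [e]
    exact (S.mul_zpow_le_iff _).2 hγ

/-- If a conjugate of `x` has larger infimum, fewer than `‖Δ‖` cyclic slidings shorten `x`. -/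
lemma exists_len_iterate_lt_of_inf_lt (hΔ : S.Δ ≠ 1) {x y : G} (hxy : IsConj x y)
    (h : S.inf x < S.inf y) :
    ∃ m < S.norm S.Δ, S.len (S.cyclicSliding^[m] x) < S.len x := by
  by_contra! hlen
  have hN : 0 < S.norm S.Δ := S.le_norm_of_pow_le hΔ (k := 1)
    (by simpa using S.le_refl S.Δ) S.garside_mem
  have hconst : ∀ j < S.norm S.Δ, S.inf (S.cyclicSliding^[j] x) = S.inf x ∧
      S.sup (S.cyclicSliding^[j] x) = S.sup x := by
    intro j hj
    have h₁ := S.inf_le_inf_iterate hΔ x j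
    have h₂ := S.sup_iterate_le_sup hΔ x j
    have h₃ := hlen j hj
    simp only [sup] at h₂ ⊢
    omega
  have hk : S.norm S.Δ - 1 < S.norm S.Δ := by omega
  have hθ := S.exists_iterate_le_translate hΔ hxy h _ rfl
  have hnot : ¬ S.le 1 (S.translate x (-(S.inf x + 1)) 1) := by
    rw [translate, mul_one, ← mul_zpow_le_iff_le_mul, one_mul, S.zpow_le_iff_le_inf hΔ]
    omega
  -- otherwise `x` has canonical length at most one, and cycling never becomes stationary
  have hr : S.inf x + 2 ≤ S.sup x := by
    by_contra! hlt
    let _ := S.semilatticeInf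
    refine hnot (le_map_of_iterate_inf_le_map (S.translate_le_translate_iff x _) ?_ hθ)
    show S.le _ _
    rw [translate, mul_one, ← le_mul_zpow_iff, one_mul, S.le_zpow_iff_sup_le hΔ]
    omega
  have hincr : ∀ (z : G) (q q' : ℤ), 0 ≤ q' + q → ∀ a,
      S.le a (S.translate z q (S.translate z⁻¹ q' a)) := by
    intro z q q' hq a
    have : S.translate z q (S.translate z⁻¹ q' a) = a * S.Δ ^ (q' + q) := by
      simp only [translate]
      rw [zpow_add]; group
    rw [this]
    simpa using (S.mul_le_mul_left_iff a).2 (S.zpow_le_zpow hq)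
  have heq := S.cyclicSliding_iterate_eq hΔ x _ (fun j hj => hconst j (hj.trans hk)) _ rfl
  have hinf := (hconst _ hk).1
  have hgood := @iterate_inf_inf_le_map G S.semilatticeInf
    (S.translate x (-(S.inf x + 1))) (S.translate x⁻¹ (S.sup x - 1))
    (S.translate_gcd _ _) (S.translate_gcd _ _) (hincr _ _ _ (by omega))
    (fun a => by
      have := hincr x⁻¹ (S.sup x - 1) (-(S.inf x + 1)) (by omega) a
      rwa [inv_inv] at this) 1 _ hθ
  change S.le ((fun a => S.gcd (S.gcd a (S.translate x (-(S.inf x + 1)) a))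
    (S.translate x⁻¹ (S.sup x - 1) a))^[S.norm S.Δ - 1] 1) (S.translate x (-(S.inf x + 1))
    ((fun a => S.gcd (S.gcd a (S.translate x (-(S.inf x + 1)) a))
      (S.translate x⁻¹ (S.sup x - 1) a))^[S.norm S.Δ - 1] 1)) at hgood
  generalize (fun a => S.gcd (S.gcd a (S.translate x (-(S.inf x + 1)) a))
    (S.translate x⁻¹ (S.sup x - 1) a))^[S.norm S.Δ - 1] 1 = w at heq hgood
  generalize ((S.norm S.Δ - 1 : ℕ) : ℤ) = k at heq
  have : S.inf x + 1 ≤ S.inf (S.cyclicSliding^[S.norm S.Δ - 1] x) := by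
    rw [← S.zpow_le_iff_le_inf hΔ, heq, mul_assoc, le_inv_mul_iff, mul_assoc w, ← zpow_add,
      add_comm k, zpow_add, ← mul_assoc, ← mul_assoc, mul_zpow_le_iff, mul_zpow_le_iff_le_mul]
    exact hgood
  omega

/-- Fewer than `‖Δ‖` cyclic slidings shorten an element which is not of minimal canonical length
in its conjugacy class: a shorter conjugate has a larger infimum or a smaller supremum, and
inversion exchanges the two cases. -/
lemma exists_len_iterate_lt (hΔ : S.Δ ≠ 1) {x y : G} (hxy : IsConj x y)
    (h : S.len y < S.len x) : ∃ m < S.norm S.Δ, S.len (S.cyclicSliding^[m] x) < S.len x := by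
  by_cases hinf : S.inf x < S.inf y
  · exact S.exists_len_iterate_lt_of_inf_lt hΔ hxy hinf
  · have hxy' : IsConj x⁻¹ y⁻¹ := by
      obtain ⟨c, rfl⟩ := isConj_iff.1 hxy
      exact isConj_iff.2 ⟨c, by group⟩
    obtain ⟨m, hm, hlt⟩ := S.exists_len_iterate_lt_of_inf_lt hΔ hxy' (by
      rw [S.inf_inv hΔ, S.inf_inv hΔ, sup, sup]
      omega)
    rw [cyclicSliding_iterate_inv, S.len_inv hΔ, S.len_inv hΔ] at hlt
    exact ⟨m, hm, hlt⟩

/-- If `Δ = 1` then `1` is the only simple element, and `G` is trivial. -/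
lemma subsingleton_of_garside_eq_one (hΔ : S.Δ = 1) : Subsingleton G := by
  have h1 : ∀ g : G, g = 1 := by
    have key : ∀ g : G, S.le g 1 := fun g => by
      obtain ⟨m, hm⟩ := S.exists_le_pow g
      rwa [hΔ, one_pow] at hm
    intro g
    refine S.le_antisymm (key g) ?_
    simpa [le, PrefixLE] using key g⁻¹
  exact ⟨fun a b => (h1 a).trans (h1 b).symm⟩

lemma exists_iterate_mem_superSummitSet (hΔ : S.Δ ≠ 1) (x : G) :
    ∃ M : ℕ, S.cyclicSliding^[M] x ∈ S.superSummitSet x := by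
  generalize hn : S.len x = n
  induction n using Nat.strong_induction_on generalizing x with
  | _ n ih =>
    by_cases h : ∃ y, IsConj x y ∧ S.len y < S.len x
    · obtain ⟨y, hxy, hlt⟩ := h
      obtain ⟨m, -, hm⟩ := S.exists_len_iterate_lt hΔ hxy hlt
      obtain ⟨M, hM, hmin⟩ := ih _ (hn ▸ hm) _ rfl
      have hc := S.isConj_cyclicSliding_iterate x m
      refine ⟨M + m, ?_⟩
      rw [Function.iterate_add_apply]
      exact ⟨hc.trans hM, fun z hz => hmin z (hc.symm.trans hz)⟩
    · push Not at h
      exact ⟨0, IsConj.refl x, h⟩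

end GarsideStructure

theorem mainTheorem6 {G : Type*} [Group G] (S : GarsideStructure G) (hS : S.IsFiniteType) :
    (∀ x : G, (∃ y : G, IsConj x y ∧ S.len y < S.len x) →
      ∃ m : ℕ, 0 < m ∧ m < S.norm S.Δ ∧ S.len (S.cyclicSliding^[m] x) < S.len x) ∧
    (∀ x : G, ∃ M : ℕ, ∀ m : ℕ, M ≤ m → S.cyclicSliding^[m] x ∈ S.superSummitSet x) := by
  by_cases hΔ : S.Δ = 1
  · have := S.subsingleton_of_garside_eq_one hΔ
    refine ⟨fun x ⟨y, _, h⟩ => ?_, fun x => ⟨0, fun m _ => ⟨?_, fun z _ => ?_⟩⟩⟩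
    · rw [Subsingleton.elim y x] at h
      exact absurd h (lt_irrefl _)
    · exact S.isConj_cyclicSliding_iterate x m
    · rw [Subsingleton.elim z]
  · refine ⟨fun x ⟨y, hxy, h⟩ => ?_, fun x => ?_⟩
    · obtain ⟨m, hm, hlt⟩ := S.exists_len_iterate_lt hΔ hxy h
      refine ⟨m, Nat.pos_of_ne_zero ?_, hm, hlt⟩
      rintro rfl
      exact lt_irrefl _ hlt
    · obtain ⟨M, hc, hmin⟩ := S.exists_iterate_mem_superSummitSet hΔ x
      refine ⟨M, fun m hm => ⟨S.isConj_cyclicSliding_iterate x m, fun z hz => ?_⟩⟩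
      obtain ⟨k, rfl⟩ := Nat.exists_eq_add_of_le' hm
      rw [Function.iterate_add_apply]
      exact (S.len_iterate_le_len hΔ _ k).trans (hmin z hz)
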